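/- Let $m,n\ge 1$ be integers and let $k$ be a field. Let $y$ be a Vigenère ciphertext over the alphabet $\mathbb{Z}/n$ obtained from a plaintext $x=x_0x_1\cdots x_{N-1}$ with a key $K=(K_0,\dots,K_{m-1})$ of length $m$, that is, $y=y_0\cdots y_{N-1}$ with $y_j=x_j+K_{j \bmod m}$. Write $|y|=N$ for its length and $f_a$ for the number of occurrences of the letter $a$ in $y$. For $0\le i<m$ let $L_i$ be the list of the letters of $y$ in the positions $j\equiv i \pmod m$. Assume that every $L_i$ has at least two entries and contains a letter $a$ with $f_a\ge 2$ (the latter holds, for instance, if every letter that occurs in $y$ occurs at least twice and no $L_i$ is empty). Let $\mathfrak{C}$ be the Brauer configuration whose polygons are the multisets $L_0,\dots,L_{m-1}$, whose vertices are the letters occurring in $y$, whose multiplicity function is $\mu=1$, and in whose orientation the successor sequence of a letter $a$ lists $L_0$, then $L_1$, and so on up to $L_{m-1}$, each $L_i$ as many times in a row as $a$ occurs in it. The valency of the vertex $a$ is thus $f_a$. Let $\Lambda_{\mathfrak{C}}$ be the Brauer configuration algebra of $\mathfrak{C}$ over $k$, in the sense of Green and Schroll: the quotient $kQ/I$ of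 the path algebra of the quiver $Q$ that has one vertex for each polygon and, for each letter $a$ with $f_a\ge 2$, one arrow from each entry of the successor sequence of $a$ to the cyclically next entry. Going once around the successor sequence of $a$, starting with any of its arrows, gives the special $a$-cycles; $I$ is the two-sided ideal generated by the differences $C-C'$ of special cycles $C,C'$ starting at the same polygon, the paths $C\alpha$ where $\alpha$ is the first arrow of the special cycle $C$, and the paths $\alpha\beta$ of length two that are not subpaths of any special cycle. Then $\Lambda_{\mathfrak{C}}$ is finite dimensional and $$\dim_k \Lambda_{\mathfrak{C}} = 2m+|y|\,(|y|-1)\,\mathscr{I}(y),\qquad \mathscr{I}(y)=\sum_{a\in\mathbb{Z}/n}\frac{f_a(f_a-1)}{|y|(|y|-1)},$$ where $\mathscr{I}(y)$ is the index of coincidence of $y$. -/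

import Mathlib

/-! ### Path algebras -/

/-- A path of arbitrary length (possibly `0`) in a quiver, together with its end points. -/
structure QuiverPath (Q : Type*) [Quiver Q] where
  src : Q
  tgt : Q
  path : Quiver.Path src tgt

/-- The path algebra `kQ`: the vector space with basis the set of all paths of `Q`. -/
def PathAlgebra (k Q : Type*) [Field k] [Quiver Q] : Type _ := QuiverPath Q →₀ k

namespace PathAlgebra

variable {k Q : Type*} [Field k] [Quiver Q]

noncomputable instance : AddCommGroup (PathAlgebra k Q) :=
  inferInstanceAs (AddCommGroup (QuiverPath Q →₀ k))

noncomputable instance : Module k (PathAlgebra k Q) :=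
  inferInstanceAs (Module k (QuiverPath Q →₀ k))

/-- The basis element of `kQ` given by a path. -/
noncomputable def of (k : Type*) [Field k] (x : QuiverPath Q) : PathAlgebra k Q :=
  Finsupp.single x (1 : k)

theorem hom_ext {M : Type*} [AddCommMonoid M] [Module k M] {f g : PathAlgebra k Q →ₗ[k] M}
    (h : ∀ x, f (of k x) = g (of k x)) : f = g :=
  Finsupp.lhom_ext' fun x => LinearMap.ext_ring (h x)

/-- The product of two paths: their concatenation (read from left to right) if the first one ends
where the second one starts, and zero otherwise. -/
noncomputable def mulPath (k : Type*) [Field k] (x y : QuiverPath Q) : PathAlgebra k Q :=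
  open Classical in
  if h : x.tgt = y.src then of k ⟨x.src, y.tgt, x.path.comp (y.path.cast h.symm rfl)⟩ else 0

/-- The multiplication of `kQ`, as the bilinear extension of the product of paths. -/
noncomputable def mulHom : PathAlgebra k Q →ₗ[k] PathAlgebra k Q →ₗ[k] PathAlgebra k Q :=
  Finsupp.linearCombination k fun x : QuiverPath Q =>
    (Finsupp.linearCombination k fun y : QuiverPath Q => mulPath k x y :
      (QuiverPath Q →₀ k) →ₗ[k] PathAlgebra k Q)

noncomputable instance : Mul (PathAlgebra k Q) := ⟨fun a b => mulHom a b⟩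

theorem mul_def (a b : PathAlgebra k Q) : a * b = mulHom a b := rfl

theorem of_mul_of (x y : QuiverPath Q) : of k x * of k y = mulPath k x y := by
  have h1 : (mulHom (of k x) : PathAlgebra k Q →ₗ[k] PathAlgebra k Q) =
      (Finsupp.linearCombination k fun y : QuiverPath Q => mulPath k x y :
      (QuiverPath Q →₀ k) →ₗ[k] PathAlgebra k Q) := by
    refine (Finsupp.linearCombination_single k (1 : k) x).trans (one_smul _ _)
  rw [mul_def, h1]
  exact (Finsupp.linearCombination_single k (1 : k) y).trans (one_smul _ _)

theorem of_mul_of_comp {p q r : Q} (u : Quiver.Path p q) (v : Quiver.Path q r) :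
    of k ⟨p, q, u⟩ * of k ⟨q, r, v⟩ = of k ⟨p, r, u.comp v⟩ := by
  rw [of_mul_of, mulPath, dif_pos rfl]
  rfl

theorem of_mul_of_ne {x y : QuiverPath Q} (h : x.tgt ≠ y.src) : of k x * of k y = 0 := by
  rw [of_mul_of, mulPath, dif_neg h]

theorem of_mul_assoc (x y z : QuiverPath Q) :
    of k x * of k y * of k z = of k x * (of k y * of k z) := by
  have zm : ∀ a : PathAlgebra k Q, (0 : PathAlgebra k Q) * a = 0 := fun a => by simp [mul_def]
  have mz : ∀ a : PathAlgebra k Q, a * (0 : PathAlgebra k Q) = 0 := fun a => by simp [mul_def]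
  obtain ⟨a, b, u⟩ := x
  obtain ⟨c, d, v⟩ := y
  obtain ⟨e, f, w⟩ := z
  by_cases h : b = c
  · subst h
    by_cases h' : d = e
    · subst h'
      simp only [of_mul_of_comp, Quiver.Path.comp_assoc]
    · rw [of_mul_of_comp, of_mul_of_ne h', of_mul_of_ne h', mz]
  · by_cases h' : d = e
    · subst h'
      rw [of_mul_of_comp, of_mul_of_ne h, of_mul_of_ne h, zm]
    · rw [of_mul_of_ne h, of_mul_of_ne h', zm, mz]

theorem mul_assoc_aux (a b c : PathAlgebra k Q) : a * b * c = a * (b * c) := by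
  have key : ∀ (x y : QuiverPath Q) (c : PathAlgebra k Q),
      of k x * of k y * c = of k x * (of k y * c) := by
    intro x y c
    have h : mulHom (mulHom (of k x) (of k y)) = (mulHom (of k x)).comp (mulHom (of k y)) :=
      hom_ext fun z => of_mul_assoc x y z
    exact LinearMap.congr_fun h c
  have key2 : ∀ (x : QuiverPath Q) (b c : PathAlgebra k Q),
      of k x * b * c = of k x * (b * c) := by
    intro x b c
    have h : (mulHom.flip c).comp (mulHom (of k x)) = (mulHom (of k x)).comp (mulHom.flip c) :=
      hom_ext fun y => key x y c
    exact LinearMap.congr_fun h b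
  have h : (mulHom.flip c).comp (mulHom.flip b) = mulHom.flip (mulHom b c) :=
    hom_ext fun x => key2 x b c
  exact LinearMap.congr_fun h a

variable [Fintype Q]

/-- The unit of `kQ` is the sum of the trivial paths. -/
noncomputable instance : One (PathAlgebra k Q) := ⟨∑ p : Q, of k ⟨p, p, Quiver.Path.nil⟩⟩

theorem one_def : (1 : PathAlgebra k Q) = ∑ p : Q, of k ⟨p, p, Quiver.Path.nil⟩ := rfl

theorem one_mul_aux (a : PathAlgebra k Q) : 1 * a = a := by
  have h : mulHom (1 : PathAlgebra k Q) = LinearMap.id := by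
    refine hom_ext fun y => ?_
    obtain ⟨a, b, u⟩ := y
    rw [one_def, map_sum, LinearMap.sum_apply, Finset.sum_eq_single a]
    · rw [← mul_def, of_mul_of_comp, Quiver.Path.nil_comp, LinearMap.id_apply]
    · exact fun p _ hp => of_mul_of_ne hp
    · exact fun h => absurd (Finset.mem_univ a) h
  exact LinearMap.congr_fun h a

theorem mul_one_aux (a : PathAlgebra k Q) : a * 1 = a := by
  have h : mulHom.flip (1 : PathAlgebra k Q) = LinearMap.id := by
    refine hom_ext fun y => ?_
    obtain ⟨a, b, u⟩ := y
    rw [one_def, map_sum, LinearMap.sum_apply, Finset.sum_eq_single b]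
    · rw [LinearMap.flip_apply, ← mul_def, of_mul_of_comp, Quiver.Path.comp_nil,
        LinearMap.id_apply]
    · intro p _ hp
      rw [LinearMap.flip_apply, ← mul_def, of_mul_of_ne (Ne.symm hp)]
    · exact fun h => absurd (Finset.mem_univ b) h
  exact LinearMap.congr_fun h a

noncomputable instance : Ring (PathAlgebra k Q) :=
  { (inferInstance : AddCommGroup (PathAlgebra k Q)),
    (inferInstance : Mul (PathAlgebra k Q)),
    (inferInstance : One (PathAlgebra k Q)) with
    left_distrib := fun a b c => map_add (mulHom a) b c
    right_distrib := fun a b c => LinearMap.map_add₂ mulHom a b c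
    zero_mul := fun a => LinearMap.map_zero₂ mulHom a
    mul_zero := fun a => map_zero (mulHom a)
    mul_assoc := mul_assoc_aux
    one_mul := one_mul_aux
    mul_one := mul_one_aux }

noncomputable instance : Algebra k (PathAlgebra k Q) :=
  Algebra.ofModule (fun r a b => LinearMap.map_smul₂ mulHom r a b)
    (fun r a b => map_smul (mulHom a) r b)

end PathAlgebra

/-! ### Brauer configurations and their algebras -/

/-- A Brauer configuration with polygons indexed by the finite set `P`. The vertices are the
elements of `V` that lie in at least one polygon; values attached to other elements of `V` play no
role. -/
structure BrauerConfiguration (V P : Type*) [DecidableEq V] [DecidableEq P] [Fintype P] where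
  /-- The polygons, as multisets of vertices. -/
  polygon : P → Multiset V
  /-- The multiplicity function. -/
  mu : V → ℕ
  /-- The orientation: the successor sequence of `α` lists the polygons containing `α`, each one as
  often as `α` occurs in it; it is read cyclically. -/
  succSeq : V → List P
  mu_pos : ∀ α, 0 < mu α
  count_succSeq : ∀ α p, (succSeq α).count p = (polygon p).count α
  two_le_card : ∀ p, 2 ≤ (polygon p).card
  /-- Every polygon has a non-truncated vertex. -/
  exists_nontruncated : ∀ p, ∃ α ∈ polygon p, 1 < mu α * ∑ q, (polygon q).count α

namespace BrauerConfiguration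

variable {V P : Type*} [DecidableEq V] [DecidableEq P] [Fintype P]
variable (Γ : BrauerConfiguration V P)

/-- The valency of a vertex. -/
def val (α : V) : ℕ := ∑ p, (Γ.polygon p).count α

/-- The arrows of the Brauer quiver. For each non-truncated vertex `α`, every entry of the successor
sequence of `α` is the source of one arrow, whose target is the cyclically next entry. -/
structure Arrow where
  vertex : V
  nontruncated : 1 < Γ.mu vertex * Γ.val vertex
  idx : Fin (Γ.succSeq vertex).length

variable {Γ}

/-- The arrow that starts at the next entry of the same cyclic successor sequence. -/
def Arrow.next (a : Γ.Arrow) : Γ.Arrow :=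
  ⟨a.vertex, a.nontruncated, ⟨(a.idx + 1) % (Γ.succSeq a.vertex).length,
    Nat.mod_lt _ (Nat.zero_lt_of_lt a.idx.2)⟩⟩

def Arrow.source (a : Γ.Arrow) : P := (Γ.succSeq a.vertex).get a.idx

def Arrow.target (a : Γ.Arrow) : P := a.next.source

variable (Γ)

/-- The vertex set of the Brauer quiver: one vertex for each polygon. -/
def QuiverVertex (_Γ : BrauerConfiguration V P) : Type _ := P

instance : Fintype Γ.QuiverVertex := inferInstanceAs (Fintype P)

/-- The Brauer quiver. -/
instance : Quiver Γ.QuiverVertex where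
  Hom p q := {a : Γ.Arrow // a.source = p ∧ a.target = q}

variable {Γ}
variable (k : Type*) [Field k]

/-- An arrow as an element of the path algebra of the Brauer quiver. -/
noncomputable def Arrow.elem (a : Γ.Arrow) : PathAlgebra k Γ.QuiverVertex :=
  PathAlgebra.of k
    ⟨a.source, a.target, Quiver.Hom.toPath (V := Γ.QuiverVertex) ⟨a, rfl, rfl⟩⟩

/-- The special cycle that starts with the arrow `a`: the path that runs once around the cyclic
successor sequence of the vertex of `a`. The special `α`-cycles at a polygon `p` are those given by
the arrows of `α` with source `p`. -/
noncomputable def Arrow.specialCycle (a : Γ.Arrow) : PathAlgebra k Γ.QuiverVertex :=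
  ((List.iterate Arrow.next a (Γ.val a.vertex)).map (Arrow.elem k)).prod

variable (Γ)

/-- The relations of the Brauer configuration algebra:
* `C ^ μ(α) - D ^ μ(β)` for special cycles `C`, `D` of vertices `α`, `β` at the same polygon;
* `C ^ μ(α) * a` where `a` is the first arrow of the special `α`-cycle `C`;
* `a * b` for composable arrows such that `b` does not follow `a` in a special cycle (run through
  repeatedly, so that the square of the loop at a vertex of valency one is not a relation). -/
inductive Relation : PathAlgebra k Γ.QuiverVertex → Prop
  | cycle_sub_cycle (a b : Γ.Arrow) (h : a.source = b.source) :
      Relation (a.specialCycle k ^ Γ.mu a.vertex - b.specialCycle k ^ Γ.mu b.vertex)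
  | cycle_mul_first (a : Γ.Arrow) :
      Relation (a.specialCycle k ^ Γ.mu a.vertex * a.elem k)
  | arrow_mul_arrow (a b : Γ.Arrow) (h : a.target = b.source) (hab : b ≠ a.next) :
      Relation (a.elem k * b.elem k)

/-- The two-sided ideal generated by the relations. -/
noncomputable def relationIdeal : Ideal (PathAlgebra k Γ.QuiverVertex) :=
  (TwoSidedIdeal.span {x | Γ.Relation k x}).asIdeal

instance : (Γ.relationIdeal k).IsTwoSided :=
  inferInstanceAs (TwoSidedIdeal.span {x | Γ.Relation k x}).asIdeal.IsTwoSided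

/-- The Brauer configuration algebra. -/
abbrev BrauerAlgebra : Type _ := PathAlgebra k Γ.QuiverVertex ⧸ Γ.relationIdeal k

end BrauerConfiguration

/-! ### The Vigenère cryptosystem -/

namespace Vigenere

/-- Vigenère encryption over the alphabet `ℤ/n` with the key `K` of length `m`: the letter in
position `j` (counted from `0`) is shifted by the key letter with index `j mod m`. -/
def encrypt {n m : ℕ} [NeZero m] (K : Fin m → ZMod n) (x : List (ZMod n)) : List (ZMod n) :=
  x.mapIdx fun j c => c + K (Fin.ofNat m j)

/-- The `i`-th of the `m` lists into which a text is split: its letters in the positions congruent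
to `i` modulo `m`. -/
def sublist {n : ℕ} (m : ℕ) (y : List (ZMod n)) (i : Fin m) : List (ZMod n) :=
  (y.zipIdx.filter fun c => c.2 % m = i).map Prod.fst

/-- The index of coincidence of a text. -/
def indexOfCoincidence {n : ℕ} [NeZero n] (y : List (ZMod n)) : ℚ :=
  ∑ a : ZMod n, ((y.count a : ℚ) * (y.count a - 1)) / ((y.length : ℚ) * (y.length - 1))

theorem sum_count_sublist {n : ℕ} (m : ℕ) [NeZero m] (y : List (ZMod n)) (a : ZMod n) :
    ∑ i : Fin m, (sublist m y i).count a = y.count a := by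
  have aux : ∀ l : List (ZMod n × ℕ),
      ∑ i : Fin m, ((l.filter fun c => c.2 % m = i).map Prod.fst).count a =
        (l.map Prod.fst).count a := by
    intro l
    induction l with
    | nil => simp
    | cons c l ih =>
      have hsum : ∀ i : Fin m,
          (((c :: l).filter fun c => c.2 % m = i).map Prod.fst).count a =
            ((l.filter fun c => c.2 % m = i).map Prod.fst).count a +
              if i = Fin.ofNat m c.2 then (if c.1 = a then 1 else 0) else 0 := by
        intro i
        by_cases h : c.2 % m = i
        · have h' : i = Fin.ofNat m c.2 := Fin.ext (by simp [h])
          rw [List.filter_cons_of_pos (by simpa using h), if_pos h', List.map_cons,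
            List.count_cons]
          simp
        · have h' : ¬ i = Fin.ofNat m c.2 := fun e => h (by simp [e])
          rw [List.filter_cons_of_neg (by simpa using h), if_neg h', add_zero]
      rw [Finset.sum_congr rfl fun i _ => hsum i, Finset.sum_add_distrib, ih, List.map_cons,
        List.count_cons]
      simp
  simpa [sublist] using aux y.zipIdx

/-- The Brauer configuration of a text `y` split into `m` lists: the polygons are these lists, the
vertices are the letters of `y`, all multiplicities are `1`, and the first list precedes the second
one, and so on, in all successor sequences. -/
def configuration {n : ℕ} (m : ℕ) [NeZero m] (y : List (ZMod n))
    (hcard : ∀ i : Fin m, 2 ≤ (sublist m y i).length)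
    (hfreq : ∀ i : Fin m, ∃ a ∈ sublist m y i, 1 < y.count a) :
    BrauerConfiguration (ZMod n) (Fin m) where
  polygon i := (sublist m y i : Multiset (ZMod n))
  mu _ := 1
  succSeq a := (List.finRange m).flatMap fun i => List.replicate ((sublist m y i).count a) i
  mu_pos _ := one_pos
  count_succSeq a p := by
    rw [List.count_flatMap, Multiset.coe_count]
    have : (List.count p ∘ fun i => List.replicate ((sublist m y i).count a) i) =
        fun i => if i = p then (sublist m y i).count a else 0 := by
      funext i
      simp [List.count_replicate]
    rw [this, ← List.ofFn_eq_map, List.sum_ofFn]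
    simp
  two_le_card i := by simpa using hcard i
  exists_nontruncated i := by
    obtain ⟨a, ha, h⟩ := hfreq i
    refine ⟨a, by simpa using ha, ?_⟩
    simpa [sum_count_sublist] using h

end Vigenere

namespace BrauerConfiguration

variable {V P : Type*} [DecidableEq V] [DecidableEq P] [Fintype P]
variable {Γ : BrauerConfiguration V P}

/-! ### Running around a successor sequence -/

/-! The relations are monomial apart from the identification of special cycles, so a basis can be
read off from paths. Call a list of arrows a run if each arrow is the `next` of the one before it; a
run is fixed by its first arrow and its length. A path of positive length that is not a run contains
a forbidden product of two arrows. A run longer than `C ^ μ(α)` contains `C ^ μ(α)` followed by its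
first arrow. Both vanish in the quotient, while the runs of length exactly `μ(α) val(α)` at a
polygon all become one socle element. What survives is a trivial path and a socle element for each
polygon, and the shorter nontrivial runs.

These classes span by the above (`ofCoord_coordHom`). They are independent because the map
`coordHom`, which sends each path to its label or to zero, kills the whole ideal
(`coordHom_eq_zero_of_mem`); hence the two maps of `coordEquiv` are mutually inverse. A vertex `α`
with `μ(α) val(α) > 1` has `val(α)` arrows, each starting `μ(α) val(α) - 1` shorter runs, so the
dimension is `2|P| + ∑ val(α) (μ(α) val(α) - 1)`. For a ciphertext `μ = 1` and `val(a) = f_a`. -/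

theorem length_succSeq (α : V) : (Γ.succSeq α).length = Γ.val α := by
  rw [val, ← Finset.sum_congr rfl fun p _ => Γ.count_succSeq α p]
  simpa using (Multiset.sum_count_eq_card (s := Finset.univ) (m := (Γ.succSeq α : Multiset P))
    (fun p _ => Finset.mem_univ p)).symm

/-- The length of the path `C ^ μ(α)`, where `C` is a special cycle of the vertex `α` of `a`. -/
def Arrow.cycleLength (a : Γ.Arrow) : ℕ := Γ.mu a.vertex * Γ.val a.vertex

theorem Arrow.one_lt_cycleLength (a : Γ.Arrow) : 1 < a.cycleLength := a.nontruncated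

theorem Arrow.next_iterate (a : Γ.Arrow) (j : ℕ) :
    Arrow.next^[j] a = ⟨a.vertex, a.nontruncated, ⟨(a.idx + j) % (Γ.succSeq a.vertex).length,
      Nat.mod_lt _ (Nat.zero_lt_of_lt a.idx.2)⟩⟩ := by
  induction j with
  | zero =>
    obtain ⟨α, h, i, hi⟩ := a
    simp [Nat.mod_eq_of_lt hi]
  | succ j ih =>
    rw [Function.iterate_succ_apply', ih]
    simp [Arrow.next, add_assoc]

theorem Arrow.vertex_next_iterate (a : Γ.Arrow) (j : ℕ) :
    (Arrow.next^[j] a).vertex = a.vertex := by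
  rw [a.next_iterate]

theorem Arrow.next_iterate_val (a : Γ.Arrow) : Arrow.next^[Γ.val a.vertex] a = a := by
  obtain ⟨α, h, i, hi⟩ := a
  rw [Arrow.next_iterate]
  simp [← length_succSeq, Nat.mod_eq_of_lt hi]

theorem Arrow.next_iterate_mul_val (a : Γ.Arrow) (j : ℕ) :
    Arrow.next^[j * Γ.val a.vertex] a = a := by
  rw [mul_comm, Function.iterate_mul, Function.iterate_fixed a.next_iterate_val]

theorem Arrow.next_iterate_cycleLength (a : Γ.Arrow) : Arrow.next^[a.cycleLength] a = a :=
  a.next_iterate_mul_val _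

theorem Arrow.cycleLength_eq_of_mem_iterate {a b : Γ.Arrow} {l : ℕ}
    (h : b ∈ List.iterate Arrow.next a l) : b.cycleLength = a.cycleLength := by
  obtain ⟨j, -, rfl⟩ := List.mem_iterate.1 h
  simp only [Arrow.cycleLength, a.vertex_next_iterate]

/-! ### Paths as lists of arrows -/

/-- The arrows of a path in the Brauer quiver. -/
def arrows {p : Γ.QuiverVertex} : ∀ {q : Γ.QuiverVertex}, Quiver.Path p q → List Γ.Arrow
  | _, .nil => []
  | _, .cons u e => arrows u ++ [e.1]

@[simp]
theorem arrows_nil (p : Γ.QuiverVertex) : arrows (Quiver.Path.nil : Quiver.Path p p) = [] := rfl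

@[simp]
theorem arrows_cons {p q r : Γ.QuiverVertex} (u : Quiver.Path p q) (e : q ⟶ r) :
    arrows (u.cons e) = arrows u ++ [e.1] := rfl

@[simp]
theorem arrows_comp {p q r : Γ.QuiverVertex} (u : Quiver.Path p q) (v : Quiver.Path q r) :
    arrows (u.comp v) = arrows u ++ arrows v := by
  induction v with
  | nil => simp
  | cons v e ih => simp [ih]

/-- The source of an arrow, as a vertex of the Brauer quiver. -/
def Arrow.src (a : Γ.Arrow) : Γ.QuiverVertex := a.source

/-- The target of an arrow, as a vertex of the Brauer quiver. -/
def Arrow.tgt (a : Γ.Arrow) : Γ.QuiverVertex := a.target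

/-- An arrow, as a morphism of the Brauer quiver. -/
def Arrow.hom (a : Γ.Arrow) : a.src ⟶ a.tgt := ⟨a, rfl, rfl⟩

theorem Arrow.src_next (a : Γ.Arrow) : a.next.src = a.tgt := rfl

/-- The path of length `l` that starts with the arrow `a` and runs around the successor sequence of
its vertex. -/
def Arrow.walk (a : Γ.Arrow) : ∀ l : ℕ, Quiver.Path a.src (Arrow.next^[l] a).src
  | 0 => .nil
  | l + 1 => (a.walk l).cons ⟨Arrow.next^[l] a, rfl, by
      rw [Function.iterate_succ_apply', Arrow.src_next]; rfl⟩

theorem Arrow.arrows_walk (a : Γ.Arrow) (l : ℕ) :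
    arrows (a.walk l) = List.iterate Arrow.next a l := by
  induction l with
  | zero => rfl
  | succ l ih => rw [Arrow.walk, arrows_cons, ih, List.iterate_add]; rfl

variable (k : Type*) [Field k]

theorem Arrow.elem_eq (a : Γ.Arrow) :
    a.elem k = PathAlgebra.of k ⟨a.src, a.tgt, a.hom.toPath⟩ := rfl

theorem of_mul_elem {p q r : Γ.QuiverVertex} (u : Quiver.Path p q) (e : q ⟶ r) :
    PathAlgebra.of k ⟨p, q, u⟩ * Arrow.elem k e.1 = PathAlgebra.of k ⟨p, r, u.cons e⟩ := by
  obtain ⟨a, h, h'⟩ := e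
  change a.src = q at h
  change a.tgt = r at h'
  subst h h'
  exact PathAlgebra.of_mul_of_comp u _

/-- The trivial path in front matters when there are no arrows: the empty product is `1`, the sum of
all trivial paths. -/
theorem of_eq_nil_mul_prod {p q : Γ.QuiverVertex} (u : Quiver.Path p q) :
    PathAlgebra.of k ⟨p, q, u⟩ =
      PathAlgebra.of k ⟨p, p, Quiver.Path.nil⟩ * ((arrows u).map (Arrow.elem k)).prod := by
  induction u with
  | nil => simp
  | cons u e ih => rw [← of_mul_elem, ih, arrows_cons, List.map_append, List.prod_append,
      List.map_singleton, List.prod_singleton, mul_assoc]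

theorem Arrow.nil_mul_elem (a : Γ.Arrow) :
    PathAlgebra.of k ⟨a.src, a.src, Quiver.Path.nil⟩ * a.elem k = a.elem k := by
  rw [Arrow.elem_eq, PathAlgebra.of_mul_of_comp, Quiver.Path.nil_comp]

theorem Arrow.of_walk (a : Γ.Arrow) {l : ℕ} (hl : 0 < l) :
    PathAlgebra.of k ⟨_, _, a.walk l⟩ =
      ((List.iterate Arrow.next a l).map (Arrow.elem k)).prod := by
  obtain ⟨l, rfl⟩ := Nat.exists_eq_add_of_lt hl
  rw [of_eq_nil_mul_prod, a.arrows_walk, zero_add, List.iterate, List.map_cons, List.prod_cons,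
    ← mul_assoc, a.nil_mul_elem k]

/-- A `Quiver.Path` grows at its end, so its first arrow is reached only by induction. This lets
`of_eq_prod` absorb the leading trivial path. -/
theorem source_eq_of_arrows {p q : Γ.QuiverVertex} (u : Quiver.Path p q) {a : Γ.Arrow}
    {l : List Γ.Arrow} (h : arrows u = a :: l) : a.src = p := by
  induction u generalizing l with
  | nil => simp at h
  | cons u e ih =>
    rw [arrows_cons] at h
    cases u with
    | nil =>
      rw [arrows_nil, List.nil_append, List.cons.injEq] at h
      exact h.1 ▸ e.2.1
    | cons u f =>
      cases hu : arrows (u.cons f) with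
      | nil => simp at hu
      | cons b l' =>
        rw [hu, List.cons_append, List.cons.injEq] at h
        exact ih (h.1 ▸ hu)

theorem of_eq_prod {p q : Γ.QuiverVertex} (u : Quiver.Path p q) (h : arrows u ≠ []) :
    PathAlgebra.of k ⟨p, q, u⟩ = ((arrows u).map (Arrow.elem k)).prod := by
  cases hu : arrows u with
  | nil => exact absurd hu h
  | cons a l =>
    obtain rfl := source_eq_of_arrows u hu
    rw [of_eq_nil_mul_prod, hu, List.map_cons, List.prod_cons, ← mul_assoc]
    exact congrArg (· * _) (a.nil_mul_elem k)

theorem Arrow.specialCycle_pow (a : Γ.Arrow) (j : ℕ) :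
    a.specialCycle k ^ j =
      ((List.iterate Arrow.next a (j * Γ.val a.vertex)).map (Arrow.elem k)).prod := by
  induction j with
  | zero => simp [List.iterate]
  | succ j ih =>
    rw [pow_succ, ih, add_mul, one_mul, List.iterate_add, List.map_append, List.prod_append,
      a.next_iterate_mul_val, Arrow.specialCycle]

theorem Arrow.specialCycle_pow_mu (a : Γ.Arrow) :
    a.specialCycle k ^ Γ.mu a.vertex =
      ((List.iterate Arrow.next a a.cycleLength).map (Arrow.elem k)).prod :=
  a.specialCycle_pow k _

/-- The path `C ^ μ(α)`, where `C` is the special cycle that starts with `a`, is closed. -/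
def Arrow.cyclePath (a : Γ.Arrow) : Quiver.Path a.src a.src :=
  (a.walk a.cycleLength).cast rfl (congrArg Arrow.src a.next_iterate_cycleLength)

theorem arrows_cast {p q r : Γ.QuiverVertex} (u : Quiver.Path p q) (h : q = r) :
    arrows (u.cast rfl h) = arrows u := by
  subst h; rfl

theorem Arrow.arrows_cyclePath (a : Γ.Arrow) :
    arrows a.cyclePath = List.iterate Arrow.next a a.cycleLength := by
  rw [Arrow.cyclePath, arrows_cast, a.arrows_walk]

theorem Arrow.specialCycle_pow_mu_eq_of (a : Γ.Arrow) :
    a.specialCycle k ^ Γ.mu a.vertex = PathAlgebra.of k ⟨_, _, a.cyclePath⟩ := by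
  have := a.one_lt_cycleLength
  rw [a.specialCycle_pow_mu k, of_eq_prod, a.arrows_cyclePath]
  rw [a.arrows_cyclePath, Ne, List.iterate_eq_nil]
  lia

/-! ### The vector space with basis the paths that survive in the quotient -/

variable (Γ) in
/-- Labels for a basis of the Brauer configuration algebra: a trivial path for each polygon, a socle
element for each polygon, and, for each arrow `a`, the path that starts with `a` and has length
`l + 1`, for `l + 1` below the length of `C ^ μ(α)`. -/
abbrev BasisIndex : Type _ :=
  Γ.QuiverVertex ⊕ Γ.QuiverVertex ⊕ Σ a : Γ.Arrow, Fin (a.cycleLength - 1)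

open Classical in
/-- The coordinates of the class of a path, given by its source and its list of arrows. -/
noncomputable def coord (p : Γ.QuiverVertex) : List Γ.Arrow → Γ.BasisIndex →₀ k
  | [] => Finsupp.single (.inl p) 1
  | a :: l =>
    if a :: l = List.iterate Arrow.next a (l.length + 1) then
      -- The run `a :: l` has `l.length + 1` arrows, so the test asks for a run strictly shorter
      -- than the full cycle.
      if h : l.length < a.cycleLength - 1 then Finsupp.single (.inr (.inr ⟨a, l.length, h⟩)) 1
      else if l.length + 1 = a.cycleLength then Finsupp.single (.inr (.inl a.src)) 1
      else 0
    else 0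

theorem coord_iterate_of_lt (p : Γ.QuiverVertex) (a : Γ.Arrow) {l : ℕ}
    (h : l < a.cycleLength - 1) :
    coord k p (List.iterate Arrow.next a (l + 1)) =
      Finsupp.single (.inr (.inr ⟨a, l, h⟩)) 1 := by
  simp only [List.iterate, coord, List.length_iterate, if_true, dif_pos h]

theorem coord_iterate_cycleLength (p : Γ.QuiverVertex) (a : Γ.Arrow) :
    coord k p (List.iterate Arrow.next a a.cycleLength) =
      Finsupp.single (.inr (.inl a.src)) 1 := by
  obtain ⟨l, hl⟩ := Nat.exists_eq_add_of_lt (Nat.zero_lt_of_lt a.one_lt_cycleLength)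
  rw [zero_add] at hl
  rw [hl]
  simp [List.iterate, coord, hl]

/-- All arrows of a run share one vertex, hence one cycle length, so any member `a` certifies that a
run is too long. A list that is not a run has coordinates zero anyway. -/
theorem coord_eq_zero_of_lt (p : Γ.QuiverVertex) {l : List Γ.Arrow} {a : Γ.Arrow} (ha : a ∈ l)
    (h : a.cycleLength < l.length) : coord k p l = 0 := by
  cases l with
  | nil => simp at ha
  | cons b l =>
    rw [coord]
    split_ifs with h1 h2 h3
    · rw [h1] at ha
      rw [Arrow.cycleLength_eq_of_mem_iterate ha, List.length_cons] at h
      lia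
    · rw [h1] at ha
      rw [Arrow.cycleLength_eq_of_mem_iterate ha, List.length_cons] at h
      lia
    · rfl
    · rfl

theorem coord_eq_zero_of_ne_next (p : Γ.QuiverVertex) (s t : List Γ.Arrow) {a b : Γ.Arrow}
    (h : b ≠ a.next) :
    coord k p (s ++ a :: b :: t) = 0 := by
  have key : ∀ (c : Γ.Arrow) (l : ℕ), s ++ a :: b :: t ≠ List.iterate Arrow.next c l := by
    induction s with
    | nil =>
      rintro c (_ | _ | l) hl
      · simp [List.iterate] at hl
      · simp [List.iterate] at hl
      · simp only [List.nil_append, List.iterate, List.cons.injEq] at hl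
        exact h (hl.2.1.trans (congrArg _ hl.1.symm))
    | cons d s ih =>
      rintro c (_ | l) hl
      · simp [List.iterate] at hl
      · simp only [List.cons_append, List.iterate, List.cons.injEq] at hl
        exact ih _ _ hl.2
  cases hl : s ++ a :: b :: t with
  | nil => simp at hl
  | cons c l => rw [coord, if_neg (hl ▸ key c _)]

variable (Γ) in
/-- The linear map that sends a path to its coordinates. -/
noncomputable def coordHom : PathAlgebra k Γ.QuiverVertex →ₗ[k] Γ.BasisIndex →₀ k :=
  Finsupp.linearCombination k fun x : QuiverPath Γ.QuiverVertex => coord k x.src (arrows x.path)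

@[simp]
theorem coordHom_of (x : QuiverPath Γ.QuiverVertex) :
    coordHom Γ k (PathAlgebra.of k x) = coord k x.src (arrows x.path) :=
  (Finsupp.linearCombination_single k (1 : k) x).trans (one_smul _ _)

/-- To show that `u * z * v` has zero coordinates for all `u` and `v`, it suffices to consider
paths `u` and `v`. -/
theorem coordHom_mul_mul_eq_zero {z : PathAlgebra k Γ.QuiverVertex}
    (h : ∀ x y, coordHom Γ k (PathAlgebra.of k x * z * PathAlgebra.of k y) = 0)
    (u v : PathAlgebra k Γ.QuiverVertex) : coordHom Γ k (u * z * v) = 0 := by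
  have h1 (x : QuiverPath Γ.QuiverVertex) (v : PathAlgebra k Γ.QuiverVertex) :
      coordHom Γ k (PathAlgebra.of k x * z * v) = 0 := by
    have : coordHom Γ k ∘ₗ PathAlgebra.mulHom (PathAlgebra.of k x * z) = 0 :=
      PathAlgebra.hom_ext fun y => h x y
    exact LinearMap.congr_fun this v
  have : coordHom Γ k ∘ₗ PathAlgebra.mulHom.flip v ∘ₗ PathAlgebra.mulHom.flip z = 0 :=
    PathAlgebra.hom_ext fun x => h1 x v
  exact LinearMap.congr_fun this u

/-- The product of paths `x`, `w`, `y` is a path or zero, and which of the two holds depends only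
on the end points of `w`. -/
theorem of_mul_of_mul_of (x y : QuiverPath Γ.QuiverVertex) (p q : Γ.QuiverVertex) :
    (∀ w : Quiver.Path p q,
      PathAlgebra.of k x * PathAlgebra.of k ⟨p, q, w⟩ * PathAlgebra.of k y = 0) ∨
    ∀ w : Quiver.Path p q,
      coordHom Γ k (PathAlgebra.of k x * PathAlgebra.of k ⟨p, q, w⟩ * PathAlgebra.of k y) =
        coord k x.src (arrows x.path ++ (arrows w ++ arrows y.path)) := by
  obtain ⟨a, b, u⟩ := x
  obtain ⟨c, d, v⟩ := y
  by_cases h : b = p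
  · by_cases h' : q = c
    · subst h h'
      refine .inr fun w => ?_
      rw [PathAlgebra.of_mul_of_comp, PathAlgebra.of_mul_of_comp, coordHom_of, arrows_comp,
        arrows_comp, List.append_assoc]
    · exact .inl fun w => by rw [mul_assoc, PathAlgebra.of_mul_of_ne h', mul_zero]
  · exact .inl fun w => by rw [PathAlgebra.of_mul_of_ne h, zero_mul]

/-- Between two paths, each monomial in a relation becomes zero or a single path, so only lists of
arrows have to be compared. -/
theorem coordHom_relation {z : PathAlgebra k Γ.QuiverVertex} (hz : Γ.Relation k z)
    (x y : QuiverPath Γ.QuiverVertex) :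
    coordHom Γ k (PathAlgebra.of k x * z * PathAlgebra.of k y) = 0 := by
  cases hz with
  | cycle_sub_cycle a b h =>
    have h' : a.src = b.src := h
    -- The cycle of `b` is based at `b.src`, which equals `a.src` only propositionally; it is
    -- transported so that both cycles have the same type.
    have hb : ∃ w : Quiver.Path a.src a.src,
        b.specialCycle k ^ Γ.mu b.vertex = PathAlgebra.of k ⟨_, _, w⟩ ∧
        arrows w = List.iterate Arrow.next b b.cycleLength := by
      rw [h']
      exact ⟨b.cyclePath, b.specialCycle_pow_mu_eq_of k, b.arrows_cyclePath⟩
    obtain ⟨w, hw, hwb⟩ := hb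
    rw [a.specialCycle_pow_mu_eq_of k, hw, mul_sub, sub_mul, map_sub, sub_eq_zero]
    rcases of_mul_of_mul_of k x y a.src a.src with H | H
    · rw [H, H]
    · rw [H, H, a.arrows_cyclePath, hwb]
      -- With trivial outer paths both cycles have the socle label of their common polygon;
      -- otherwise both products are too long.
      by_cases hxy : arrows x.path = [] ∧ arrows y.path = []
      · rw [hxy.1, hxy.2, List.append_nil, List.append_nil, List.nil_append, List.nil_append,
          coord_iterate_cycleLength, coord_iterate_cycleLength, h']
      · have hlen : 0 < (arrows x.path).length + (arrows y.path).length := by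
          rcases not_and_or.1 hxy with h | h <;> have := List.length_pos_of_ne_nil h <;> lia
        have key (c : Γ.Arrow) : coord k x.src (arrows x.path ++
            (List.iterate Arrow.next c c.cycleLength ++ arrows y.path)) = 0 := by
          refine coord_eq_zero_of_lt k _ (a := c) ?_ ?_
          · have hc : c ∈ List.iterate Arrow.next c c.cycleLength :=
              List.mem_iterate.2 ⟨0, Nat.zero_lt_of_lt c.one_lt_cycleLength, rfl⟩
            simp [hc]
          · simp only [List.length_append, List.length_iterate]
            lia
        rw [key, key]
  | cycle_mul_first a =>
    rw [a.specialCycle_pow_mu_eq_of k, Arrow.elem_eq, PathAlgebra.of_mul_of_comp]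
    rcases of_mul_of_mul_of k x y a.src a.tgt with H | H
    · rw [H, map_zero]
    · rw [H]
      refine coord_eq_zero_of_lt k _ (a := a) ?_ ?_
      · simp [Quiver.Hom.toPath, Arrow.hom]
      · simp only [arrows_comp, a.arrows_cyclePath, List.length_append, List.length_iterate,
          Quiver.Hom.toPath, arrows_cons, List.length_singleton]
        lia
  | arrow_mul_arrow a b h hab =>
    have hb : ∃ w : Quiver.Path a.tgt b.tgt,
        b.elem k = PathAlgebra.of k ⟨_, _, w⟩ ∧ arrows w = [b] := by
      rw [show a.tgt = b.src from h]
      exact ⟨_, rfl, rfl⟩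
    obtain ⟨w, hw, hwb⟩ := hb
    rw [hw, Arrow.elem_eq, PathAlgebra.of_mul_of_comp]
    rcases of_mul_of_mul_of k x y a.src b.tgt with H | H
    · rw [H, map_zero]
    · rw [H, arrows_comp, hwb]
      exact coord_eq_zero_of_ne_next k _ _ _ hab

theorem coordHom_eq_zero_of_mem {z : PathAlgebra k Γ.QuiverVertex}
    (hz : z ∈ Γ.relationIdeal k) : coordHom Γ k z = 0 := by
  -- The claim is strengthened to all two-sided multiples so that the induction passes through
  -- absorption.
  have key : ∀ u v, coordHom Γ k (u * z * v) = 0 := by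
    rw [relationIdeal, TwoSidedIdeal.mem_asIdeal] at hz
    induction hz using TwoSidedIdeal.span_induction with
    | mem z hz => exact coordHom_mul_mul_eq_zero k (coordHom_relation k hz)
    | zero => simp
    | add x y _ _ hx hy => intro u v; rw [mul_add, add_mul, map_add, hx, hy, add_zero]
    | neg x _ hx => intro u v; rw [mul_neg, neg_mul, map_neg, hx, neg_zero]
    | left_absorb a x _ hx => intro u v; rw [← mul_assoc]; exact hx _ _
    | right_absorb b x _ hx => intro u v; rw [← mul_assoc, mul_assoc]; exact hx _ _
  simpa using key 1 1

/-! ### The basis of the Brauer configuration algebra -/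

variable (Γ) in
/-- The projection of the path algebra onto the Brauer configuration algebra. -/
noncomputable def toBrauerAlgebra : PathAlgebra k Γ.QuiverVertex →ₐ[k] Γ.BrauerAlgebra k :=
  Ideal.Quotient.mkₐ k (Γ.relationIdeal k)

theorem toBrauerAlgebra_surjective : Function.Surjective (toBrauerAlgebra Γ k) :=
  Ideal.Quotient.mkₐ_surjective k _

theorem toBrauerAlgebra_relation {z : PathAlgebra k Γ.QuiverVertex} (hz : Γ.Relation k z) :
    toBrauerAlgebra Γ k z = 0 :=
  Ideal.Quotient.eq_zero_iff_mem.2 (TwoSidedIdeal.mem_asIdeal.2 (TwoSidedIdeal.subset_span hz))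

/-- Composability need not be assumed: a product of non-composable arrows is already zero in the
path algebra. -/
theorem toBrauerAlgebra_elem_mul_elem {a b : Γ.Arrow} (h : b ≠ a.next) :
    toBrauerAlgebra Γ k (a.elem k) * toBrauerAlgebra Γ k (b.elem k) = 0 := by
  rw [← map_mul]
  by_cases hab : a.target = b.source
  · exact toBrauerAlgebra_relation k (.arrow_mul_arrow a b hab h)
  · rw [Arrow.elem, Arrow.elem, PathAlgebra.of_mul_of_ne hab, map_zero]

theorem toBrauerAlgebra_prod_eq_zero {a : Γ.Arrow} {l : List Γ.Arrow}
    (h : a :: l ≠ List.iterate Arrow.next a (l.length + 1)) :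
    toBrauerAlgebra Γ k (((a :: l).map (Arrow.elem k)).prod) = 0 := by
  induction l generalizing a with
  | nil => simp [List.iterate] at h
  | cons b l ih =>
    rw [List.map_cons, List.prod_cons, map_mul]
    by_cases hb : b = a.next
    · subst hb
      rw [ih, mul_zero]
      intro hl
      apply h
      rw [List.length_cons, List.iterate, ← hl]
    · rw [List.map_cons, List.prod_cons, map_mul, ← mul_assoc, toBrauerAlgebra_elem_mul_elem k hb,
        zero_mul]

theorem toBrauerAlgebra_prod_iterate_eq_zero (a : Γ.Arrow) {l : ℕ} (h : a.cycleLength < l) :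
    toBrauerAlgebra Γ k ((List.iterate Arrow.next a l).map (Arrow.elem k)).prod = 0 := by
  obtain ⟨j, rfl⟩ := Nat.exists_eq_add_of_lt h
  rw [add_assoc, List.iterate_add, List.map_append, List.prod_append, Arrow.cycleLength,
    a.next_iterate_mul_val, List.iterate, List.map_cons, List.prod_cons, ← mul_assoc, map_mul,
    ← a.specialCycle_pow k _, toBrauerAlgebra_relation k (.cycle_mul_first a), zero_mul]

/-- This is where the non-truncated vertex in each polygon enters: it makes a socle element
available at every polygon. -/
theorem exists_arrow_src (p : Γ.QuiverVertex) : ∃ a : Γ.Arrow, a.src = p := by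
  obtain ⟨α, hα, h⟩ := Γ.exists_nontruncated p
  have hp : 0 < (Γ.succSeq α).count (α := P) p := (Γ.count_succSeq α p).symm ▸ Multiset.count_pos.2 hα
  obtain ⟨i, hi⟩ := List.get_of_mem (List.count_pos_iff (α := P).1 hp)
  exact ⟨⟨α, h, i⟩, hi⟩

/-- The basis element with a given label. -/
noncomputable def basisElem : Γ.BasisIndex → Γ.BrauerAlgebra k
  | .inl p => toBrauerAlgebra Γ k (PathAlgebra.of k ⟨p, p, Quiver.Path.nil⟩)
  | .inr (.inl p) => toBrauerAlgebra Γ k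
      (PathAlgebra.of k ⟨_, _, (exists_arrow_src p).choose.cyclePath⟩)
  | .inr (.inr ⟨a, l⟩) => toBrauerAlgebra Γ k (PathAlgebra.of k ⟨_, _, a.walk (l + 1)⟩)

variable (Γ) in
/-- The linear map that sends coordinates to the corresponding element of the algebra. -/
noncomputable def ofCoord : (Γ.BasisIndex →₀ k) →ₗ[k] Γ.BrauerAlgebra k :=
  Finsupp.linearCombination k (basisElem k)

@[simp]
theorem ofCoord_single (i : Γ.BasisIndex) :
    ofCoord Γ k (Finsupp.single i 1) = basisElem k i := by
  rw [ofCoord, Finsupp.linearCombination_single, one_smul]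

theorem ofCoord_coordHom (z : PathAlgebra k Γ.QuiverVertex) :
    ofCoord Γ k (coordHom Γ k z) = toBrauerAlgebra Γ k z := by
  suffices h : ofCoord Γ k ∘ₗ coordHom Γ k = (toBrauerAlgebra Γ k).toLinearMap from
    LinearMap.congr_fun h z
  refine PathAlgebra.hom_ext fun x => ?_
  obtain ⟨p, q, u⟩ := x
  rw [LinearMap.comp_apply, coordHom_of, AlgHom.toLinearMap_apply]
  cases hu : arrows u with
  | nil =>
    cases u with
    | nil => rw [coord, ofCoord_single]; rfl
    | cons u e => simp at hu
  | cons a l =>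
    rw [of_eq_prod k u (by simp [hu]), hu]
    simp only [coord]
    split_ifs with h1 h2 h3
    · rw [ofCoord_single, basisElem, a.of_walk k (Nat.succ_pos _), ← h1]
    -- The socle element was defined through an arbitrarily chosen cycle at the polygon; a relation
    -- identifies it with the present one.
    · rw [ofCoord_single, basisElem, ← Arrow.specialCycle_pow_mu_eq_of, h1, h3,
        ← a.specialCycle_pow_mu k, ← sub_eq_zero, ← map_sub]
      exact toBrauerAlgebra_relation k (.cycle_sub_cycle _ _ (exists_arrow_src a.src).choose_spec)
    · rw [map_zero, h1, toBrauerAlgebra_prod_iterate_eq_zero]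
      lia
    · rw [map_zero, toBrauerAlgebra_prod_eq_zero k h1]

variable (Γ) in
/-- The linear map that sends an element of the Brauer configuration algebra to its coordinates. -/
noncomputable def toCoord : Γ.BrauerAlgebra k →ₗ[k] Γ.BasisIndex →₀ k :=
  ((Γ.relationIdeal k).restrictScalars k).liftQ (coordHom Γ k)
    fun _ hz => coordHom_eq_zero_of_mem k hz

theorem toCoord_toBrauerAlgebra (z : PathAlgebra k Γ.QuiverVertex) :
    toCoord Γ k (toBrauerAlgebra Γ k z) = coordHom Γ k z := rfl

theorem toCoord_basisElem (i : Γ.BasisIndex) :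
    toCoord Γ k (basisElem k i) = Finsupp.single i 1 := by
  rcases i with p | p | ⟨a, l, hl⟩
  · rw [basisElem, toCoord_toBrauerAlgebra, coordHom_of, arrows_nil, coord]
  · rw [basisElem, toCoord_toBrauerAlgebra, coordHom_of, Arrow.arrows_cyclePath,
      coord_iterate_cycleLength, (exists_arrow_src p).choose_spec]
  · rw [basisElem, toCoord_toBrauerAlgebra, coordHom_of, Arrow.arrows_walk, coord_iterate_of_lt]

variable (Γ) in
/-- The Brauer configuration algebra in coordinates. -/
noncomputable def coordEquiv : Γ.BrauerAlgebra k ≃ₗ[k] Γ.BasisIndex →₀ k :=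
  LinearEquiv.ofLinearMap (toCoord Γ k) (ofCoord Γ k)
    (Finsupp.lhom_ext' fun i => LinearMap.ext_ring <| by
      simpa using toCoord_basisElem k i)
    (LinearMap.ext fun z => by
      obtain ⟨z, rfl⟩ := toBrauerAlgebra_surjective k z
      rw [LinearMap.comp_apply, toCoord_toBrauerAlgebra, ofCoord_coordHom, LinearMap.id_apply])

/-! ### The dimension -/

variable (Γ) in
/-- An arrow is a non-truncated vertex together with an entry of its successor sequence. -/
def arrowEquiv :
    Γ.Arrow ≃ Σ α : {α : V // 1 < Γ.mu α * Γ.val α}, Fin (Γ.succSeq α).length where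
  toFun a := ⟨⟨a.vertex, a.nontruncated⟩, a.idx⟩
  invFun x := ⟨x.1, x.1.2, x.2⟩

instance [Fintype V] : Fintype Γ.Arrow := Fintype.ofEquiv _ (arrowEquiv Γ).symm

theorem sum_cycleLength_sub_one [Fintype V] :
    ∑ a : Γ.Arrow, (a.cycleLength - 1) = ∑ α, Γ.val α * (Γ.mu α * Γ.val α - 1) := by
  rw [← (arrowEquiv Γ).symm.sum_comp, Fintype.sum_sigma]
  simp only [arrowEquiv, Arrow.cycleLength, Equiv.coe_fn_symm_mk, Finset.sum_const,
    Finset.card_univ, Fintype.card_fin, length_succSeq, smul_eq_mul]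
  -- Truncated vertices carry no arrows; their terms on the right vanish because `μ val ≤ 1` makes
  -- the truncated subtraction zero.
  rw [← Fintype.sum_subtype_add_sum_subtype (fun α => 1 < Γ.mu α * Γ.val α)
    fun α => Γ.val α * (Γ.mu α * Γ.val α - 1), left_eq_add]
  refine Finset.sum_eq_zero fun α _ => ?_
  rw [Nat.sub_eq_zero_of_le (not_lt.1 α.2), mul_zero]

theorem finite_brauerAlgebra [Fintype V] : Module.Finite k (Γ.BrauerAlgebra k) :=
  Module.Finite.equiv (coordEquiv Γ k).symm

theorem finrank_brauerAlgebra [Fintype V] :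
    Module.finrank k (Γ.BrauerAlgebra k) =
      2 * Fintype.card P + ∑ α, Γ.val α * (Γ.mu α * Γ.val α - 1) := by
  rw [(coordEquiv Γ k).finrank_eq, Module.finrank_finsupp_self, Fintype.card_sum, Fintype.card_sum,
    Fintype.card_sigma, show Fintype.card Γ.QuiverVertex = Fintype.card P from rfl,
    ← sum_cycleLength_sub_one]
  simp only [Fintype.card_fin]
  ring

end BrauerConfiguration

/-! ### The dimension for a Vigenère ciphertext -/

theorem theorem3p2 (k : Type*) [Field k] (n m : ℕ) [NeZero n] [NeZero m]
    (K : Fin m → ZMod n) (x y : List (ZMod n)) (hy : y = Vigenere.encrypt K x)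
    (hcard : ∀ i : Fin m, 2 ≤ (Vigenere.sublist m y i).length)
    (hfreq : ∀ i : Fin m, ∃ a ∈ Vigenere.sublist m y i, 1 < y.count a) :
    Module.Finite k ((Vigenere.configuration m y hcard hfreq).BrauerAlgebra k) ∧
    (Module.finrank k ((Vigenere.configuration m y hcard hfreq).BrauerAlgebra k) : ℚ) =
      2 * m + y.length * (y.length - 1) * Vigenere.indexOfCoincidence y := by
  refine ⟨BrauerConfiguration.finite_brauerAlgebra k, ?_⟩
  have hval (a : ZMod n) : (Vigenere.configuration m y hcard hfreq).val a = y.count a := by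
    simp [BrauerConfiguration.val, Vigenere.configuration, Vigenere.sum_count_sublist]
  -- The list `L_0` alone has two entries, so the denominator of the index of coincidence is nonzero
  -- and cancels.
  have hlen : 2 ≤ y.length := by
    refine (hcard 0).trans ?_
    rw [Vigenere.sublist, List.length_map]
    exact (List.length_filter_le _ _).trans (by simp)
  have hlen' : (2 : ℚ) ≤ y.length := by exact_mod_cast hlen
  have hne : (y.length : ℚ) * (y.length - 1) ≠ 0 :=
    mul_ne_zero (by linarith) (by linarith)
  rw [BrauerConfiguration.finrank_brauerAlgebra, Vigenere.indexOfCoincidence, ← Finset.sum_div,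
    mul_div_cancel₀ _ hne, Fintype.card_fin]
  push_cast
  congr 1
  refine Finset.sum_congr rfl fun a _ => ?_
  rw [hval, show (Vigenere.configuration m y hcard hfreq).mu a = 1 from rfl, one_mul]
  -- The natural number `f_a - 1` casts to the rational `f_a - 1` only if `f_a ≥ 1`; for `f_a = 0`
  -- the other factor vanishes.
  rcases Nat.eq_zero_or_pos (y.count a) with h | h
  · simp [h]
  · rw [Nat.cast_sub h, Nat.cast_one]
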